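/- Conventions. Hilbert spaces are complex, $\otimes$ between Hilbert spaces is the Hilbert-space tensor product, and inner products are linear in the second argument. Let $\mathsf{h}$ and $\mathsf{k}$ be Hilbert spaces, and let $\mathcal{A}\subseteq B(\mathsf{h})$ be a von Neumann algebra. For an interval $J\subseteq\mathbb{R}_+$ let $\mathcal{F}_J$ be the Boson Fock space over $L^2(J;\mathsf{k})$, with exponential vectors $e(f)$, so that $\langle e(f),e(g)\rangle=\exp\langle f,g\rangle$, and vacuum vector $\Omega_J=e(0)$; write $\mathcal{F}=\mathcal{F}_{[0,\infty)}$, $\mathcal{F}_{t)}=\mathcal{F}_{[0,t)}$, $\mathcal{F}_{[t}=\mathcal{F}_{[t,\infty)}$, and similarly $\Omega$, $\Omega_{[t}$. Identify $\mathcal{F}$ with $\mathcal{F}_{t)}\otimes\mathcal{F}_{[t}$ through $e(f)\mapsto e(f|_{[0,t)})\otimes e(f|_{[t,\infty)})$. For a Hilbert space $\mathsf{K}$, $\mathcal{A}\,\overline{\otimes}\,B(\mathsf{K})$ is the ultraweak closure in $B(\mathsf{h}\otimes\mathsf{K})$ of the span of the operators $a\otimes b$ with $a\in\mathcal{A}$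 and $b\in B(\mathsf{K})$. A linear map is normal if it is ultraweakly continuous. Let $S_t:\mathcal{F}\to\mathcal{F}_{[t}$ be the unitary with $S_te(f)=e(f(\cdot-t))$, and let $$\sigma_t:\mathcal{A}\,\overline{\otimes}\,B(\mathcal{F})\to\mathcal{A}\,\overline{\otimes}\,B(\mathcal{F}_{[t}),\qquad \sigma_t(T)=(1\otimes S_t)\,T\,(1\otimes S_t)^*.$$ A vacuum-adapted quantum stochastic cocycle on $\mathcal{A}$ is a family $k=(k_t)_{t\ge0}$ of normal completely bounded linear maps $k_t:\mathcal{A}\to\mathcal{A}\,\overline{\otimes}\,B(\mathcal{F})$ such that, for all $a\in\mathcal{A}$ and $s,t\ge0$, (i) $k_0(a)=a\otimes|\Omega\rangle\langle\Omega|$; (ii) $k_t(a)=k_{t)}(a)\otimes|\Omega_{[t}\rangle\langle\Omega_{[t}|$ for some (necessarily unique) $k_{t)}(a)\in\mathcal{A}\,\overline{\otimes}\,B(\mathcal{F}_{t)})$; (iii) $k_{s+t}=\widehat{k}_s\circ\sigma_s\circ k_t$, where $\widehat{k}_s=k_{s)}\,\overline{\otimes}\,\mathrm{id}_{B(\mathcal{F}_{[s})}$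 is the normal linear map on $\mathcal{A}\,\overline{\otimes}\,B(\mathcal{F}_{[s})$ with $a\otimes b\mapsto k_{s)}(a)\otimes b$; (iv) $r\mapsto k_r(a)$ is ultraweakly continuous on $[0,\infty)$. Let $\mathbb{E}=\mathrm{id}_{\mathcal{A}}\,\overline{\otimes}\,\omega_\Omega:\mathcal{A}\,\overline{\otimes}\,B(\mathcal{F})\to\mathcal{A}$ be the vacuum expectation, so that $\langle u,\mathbb{E}(T)v\rangle=\langle u\otimes\Omega,T(v\otimes\Omega)\rangle$ for all $u,v\in\mathsf{h}$. **Proposition.** Let $k$ be a vacuum-adapted quantum stochastic cocycle on $\mathcal{A}$, and let $P_t=\mathbb{E}\circ k_t:\mathcal{A}\to\mathcal{A}$ for $t\ge0$. Then each $P_t$ is normal and completely bounded, $P_0=\mathrm{id}_{\mathcal{A}}$, $P_{s+t}=P_s\circ P_t$ for all $s,t\ge0$, and $t\mapsto P_t(a)$ is ultraweakly continuous on $[0,\infty)$ for every $a\in\mathcal{A}$. (The family $(P_t)_{t\ge0}$ is called the vacuum-expectation semigroup of $k$.) -/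

import Mathlib

open scoped InnerProductSpace TensorProduct NNReal Topology
namespace QS

section Total

/-- A family is total if its closed linear span is the whole space. -/
def IsTotal {ι H : Type*} [NormedAddCommGroup H] [InnerProductSpace ℂ H] (x : ι → H) : Prop :=
  (Submodule.span ℂ (Set.range x)).topologicalClosure = ⊤

variable {ι H K : Type*} [NormedAddCommGroup H] [InnerProductSpace ℂ H]
  [NormedAddCommGroup K] [InnerProductSpace ℂ K]

theorem IsTotal.denseRange {x : ι → H} (hx : IsTotal x) :
    DenseRange (Finsupp.linearCombination ℂ x) := by
  have h := (Submodule.dense_iff_topologicalClosure_eq_top).2 hx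
  rw [← Finsupp.range_linearCombination] at h
  rwa [LinearMap.coe_range] at h

theorem norm_linearCombination_eq {x : ι → H} {y : ι → K}
    (h : ∀ i j, ⟪x i, x j⟫_ℂ = ⟪y i, y j⟫_ℂ) (c : ι →₀ ℂ) :
    ‖Finsupp.linearCombination ℂ y c‖ = ‖Finsupp.linearCombination ℂ x c‖ := by
  have : ⟪Finsupp.linearCombination ℂ y c, Finsupp.linearCombination ℂ y c⟫_ℂ =
      ⟪Finsupp.linearCombination ℂ x c, Finsupp.linearCombination ℂ x c⟫_ℂ := by
    simp only [Finsupp.linearCombination_apply, Finsupp.sum, sum_inner, inner_sum,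
      inner_smul_left, inner_smul_right, h]
  rw [@norm_eq_sqrt_re_inner ℂ, @norm_eq_sqrt_re_inner ℂ, this]

variable [CompleteSpace K]

/-- The isometry carrying a total family to a family with the same Gram matrix. -/
noncomputable def gramIsometry (x : ι → H) (y : ι → K) (hx : IsTotal x)
    (h : ∀ i j, ⟪x i, x j⟫_ℂ = ⟪y i, y j⟫_ℂ) : H →ₗᵢ[ℂ] K where
  toLinearMap :=
    ((Finsupp.linearCombination ℂ y).extendOfNorm (Finsupp.linearCombination ℂ x)).toLinearMap
  norm_map' := by
    refine hx.denseRange.induction ?_ (isClosed_eq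
      (((Finsupp.linearCombination ℂ y).extendOfNorm
        (Finsupp.linearCombination ℂ x)).continuous.norm) continuous_norm)
    rintro _ ⟨c, rfl⟩
    have := LinearMap.extendOfNorm_eq (f := Finsupp.linearCombination ℂ y) hx.denseRange
      ⟨1, fun c => by rw [one_mul, norm_linearCombination_eq h]⟩ c
    simp only [ContinuousLinearMap.coe_coe]
    rw [this, norm_linearCombination_eq h]

theorem gramIsometry_apply (x : ι → H) (y : ι → K) (hx : IsTotal x)
    (h : ∀ i j, ⟪x i, x j⟫_ℂ = ⟪y i, y j⟫_ℂ) (i : ι) : gramIsometry x y hx h (x i) = y i := by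
  have := LinearMap.extendOfNorm_eq (f := Finsupp.linearCombination ℂ y) hx.denseRange
      ⟨1, fun c => by rw [one_mul, norm_linearCombination_eq h]⟩ (Finsupp.single i 1)
  simp only [Finsupp.linearCombination_single, one_smul] at this
  exact this

/-- The unitary carrying a total family to a total family with the same Gram matrix. -/
noncomputable def gramUnitary [CompleteSpace H] (x : ι → H) (y : ι → K) (hx : IsTotal x)
    (hy : IsTotal y) (h : ∀ i j, ⟪x i, x j⟫_ℂ = ⟪y i, y j⟫_ℂ) : H ≃ₗᵢ[ℂ] K :=
  (LinearEquiv.refl ℂ (ι →₀ ℂ)).extendOfIsometry (Finsupp.linearCombination ℂ x)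
    (Finsupp.linearCombination ℂ y) hx.denseRange hy.denseRange
    (fun c => norm_linearCombination_eq h c)

theorem gramUnitary_apply [CompleteSpace H] (x : ι → H) (y : ι → K) (hx : IsTotal x)
    (hy : IsTotal y) (h : ∀ i j, ⟪x i, x j⟫_ℂ = ⟪y i, y j⟫_ℂ) (i : ι) :
    gramUnitary x y hx hy h (x i) = y i := by
  have := LinearEquiv.extendOfIsometry_eq (LinearEquiv.refl ℂ (ι →₀ ℂ))
    (Finsupp.linearCombination ℂ x) (Finsupp.linearCombination ℂ y) hx.denseRange hy.denseRange
    (fun c => norm_linearCombination_eq h c) (Finsupp.single i 1)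
  simp only [LinearEquiv.refl_apply, Finsupp.linearCombination_single, one_smul] at this
  exact this

end Total

section HTensor

variable (H K : Type*) [NormedAddCommGroup H] [InnerProductSpace ℂ H]
  [NormedAddCommGroup K] [InnerProductSpace ℂ K]

/-- The Hilbert-space tensor product: the completion of the algebraic tensor product. -/
def HTensor : Type _ := UniformSpace.Completion (H ⊗[ℂ] K)

noncomputable instance : NormedAddCommGroup (HTensor H K) :=
  inferInstanceAs (NormedAddCommGroup (UniformSpace.Completion (H ⊗[ℂ] K)))
noncomputable instance : InnerProductSpace ℂ (HTensor H K) :=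
  inferInstanceAs (InnerProductSpace ℂ (UniformSpace.Completion (H ⊗[ℂ] K)))
instance : CompleteSpace (HTensor H K) :=
  inferInstanceAs (CompleteSpace (UniformSpace.Completion (H ⊗[ℂ] K)))

variable {H K}
variable {H' K' : Type*} [NormedAddCommGroup H'] [InnerProductSpace ℂ H']
  [NormedAddCommGroup K'] [InnerProductSpace ℂ K']

namespace HTensor

/-- The inclusion of the algebraic tensor product. -/
noncomputable def coeL : H ⊗[ℂ] K →L[ℂ] HTensor H K :=
  (UniformSpace.Completion.toComplₗᵢ (𝕜 := ℂ) (E := H ⊗[ℂ] K)).toContinuousLinearMap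

/-- The continuous bilinear map `(u, x) ↦ u ⊗ x`. -/
noncomputable def mkL : H →L[ℂ] K →L[ℂ] HTensor H K :=
  (ContinuousLinearMap.compL ℂ K (H ⊗[ℂ] K) (HTensor H K) coeL) ∘L TensorProduct.mkL ℂ H K

/-- The elementary tensor `u ⊗ x`. -/
noncomputable def tmul (u : H) (x : K) : HTensor H K := mkL u x

theorem tmul_eq_coe (u : H) (x : K) :
    tmul u x = ((u ⊗ₜ[ℂ] x : H ⊗[ℂ] K) : UniformSpace.Completion (H ⊗[ℂ] K)) := rfl

theorem inner_tmul (u u' : H) (x x' : K) :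
    ⟪tmul u x, tmul u' x'⟫_ℂ = ⟪u, u'⟫_ℂ * ⟪x, x'⟫_ℂ :=
  (UniformSpace.Completion.inner_coe (𝕜 := ℂ) (u ⊗ₜ[ℂ] x) (u' ⊗ₜ[ℂ] x')).trans
    (TensorProduct.inner_tmul ℂ u u' x x')

theorem isTotal_tmul : IsTotal (fun p : H × K => tmul p.1 p.2) := by
  rw [IsTotal, ← Submodule.dense_iff_topologicalClosure_eq_top]
  have h := UniformSpace.Completion.denseRange_coe (α := H ⊗[ℂ] K)
  refine h.mono ?_
  rintro _ ⟨z, rfl⟩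
  change (coeL z : HTensor H K) ∈
    Submodule.span ℂ (Set.range fun p : H × K => (tmul p.1 p.2 : HTensor H K))
  induction z using TensorProduct.induction_on with
  | zero =>
    rw [map_zero]
    exact Submodule.zero_mem _
  | tmul u x => exact Submodule.subset_span ⟨(u, x), rfl⟩
  | add z w hz hw =>
    rw [map_add]
    exact Submodule.add_mem _ hz hw

/-- Elementary tensors of two total families form a total family. -/
theorem isTotal_tmul_of_isTotal {ι κ : Type*} {x : ι → H} {y : κ → K} (hx : IsTotal x)
    (hy : IsTotal y) : IsTotal (fun p : ι × κ => tmul (x p.1) (y p.2)) := by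
  set S := (Submodule.span ℂ (Set.range fun p : ι × κ => tmul (x p.1) (y p.2))).topologicalClosure
    with hS
  have hc : IsClosed (S : Set (HTensor H K)) := Submodule.isClosed_topologicalClosure _
  have h1 : ∀ (i : ι) (w : K), tmul (x i) w ∈ S := by
    intro i
    have : Submodule.span ℂ (Set.range y) ≤ S.comap (mkL (x i)).toLinearMap := by
      rw [Submodule.span_le]
      rintro _ ⟨j, rfl⟩
      exact Submodule.le_topologicalClosure _ (Submodule.subset_span ⟨(i, j), rfl⟩)
    have h2 := Submodule.topologicalClosure_minimal _ this (hc.preimage (mkL (x i)).continuous)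
    intro w
    exact h2 (hy ▸ Submodule.mem_top)
  have h2 : ∀ (w : K) (u : H), tmul u w ∈ S := by
    intro w
    have : Submodule.span ℂ (Set.range x) ≤ S.comap (mkL.flip w).toLinearMap := by
      rw [Submodule.span_le]
      rintro _ ⟨j, rfl⟩
      exact h1 j w
    have h2 := Submodule.topologicalClosure_minimal _ this (hc.preimage (mkL.flip w).continuous)
    intro u
    exact h2 (hx ▸ Submodule.mem_top)
  refine top_le_iff.1 ?_
  rw [← isTotal_tmul (H := H) (K := K)]
  refine Submodule.topologicalClosure_minimal _ ?_ hc
  rw [Submodule.span_le]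
  rintro _ ⟨p, rfl⟩
  exact h2 p.2 p.1

/-- The tensor product `a ⊗ b` of bounded operators. -/
noncomputable def map (a : H →L[ℂ] H') (b : K →L[ℂ] K') : HTensor H K →L[ℂ] HTensor H' K' :=
  ContinuousLinearMap.completion (TensorProduct.mapL a b)

theorem map_tmul (a : H →L[ℂ] H') (b : K →L[ℂ] K') (u : H) (x : K) :
    map a b (tmul u x) = tmul (a u) (b x) :=
  ContinuousLinearMap.completion_apply_coe (TensorProduct.mapL a b) (u ⊗ₜ[ℂ] x)

/-- The operator `E_x : u ↦ u ⊗ x`. -/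
noncomputable def E (H : Type*) [NormedAddCommGroup H] [InnerProductSpace ℂ H] (x : K) :
    H →L[ℂ] HTensor H K := mkL.flip x

theorem E_apply (x : K) (u : H) : E H x u = tmul u x := rfl

/-- Two operators which agree on elementary tensors are equal. -/
theorem ext_tmul {L : Type*} [NormedAddCommGroup L] [InnerProductSpace ℂ L]
    {S T : HTensor H K →L[ℂ] L} (h : ∀ u x, S (tmul u x) = T (tmul u x)) : S = T := by
  refine ContinuousLinearMap.ext_on
    (s := Set.range fun p : H × K => (tmul p.1 p.2 : HTensor H K))
    ((Submodule.dense_iff_topologicalClosure_eq_top).2 (isTotal_tmul (H := H) (K := K))) ?_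
  rintro _ ⟨p, rfl⟩
  exact h p.1 p.2

end HTensor
end HTensor

section BosonFock

open Matrix Filter
open scoped ComplexOrder

variable (H : Type*) [NormedAddCommGroup H] [InnerProductSpace ℂ H]

/-- The kernel `(f, g) ↦ exp ⟪f, g⟫`, with values in the operators on `ℂ`. -/
noncomputable def expKernel : Matrix H H (ℂ →L[ℂ] ℂ) :=
  Matrix.of fun f g => Complex.exp ⟪f, g⟫_ℂ • ContinuousLinearMap.id ℂ ℂ

theorem exp_gram_posSemidef {ι : Type*} [Fintype ι] (v : ι → H) :
    (Matrix.of fun i j => Complex.exp ⟪v i, v j⟫_ℂ).PosSemidef := by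
  classical
  have hpow : ∀ n : ℕ, (Matrix.of fun i j => ⟪v i, v j⟫_ℂ ^ n).PosSemidef := by
    intro n
    induction n with
    | zero =>
      have : (Matrix.of fun i j => ⟪v i, v j⟫_ℂ ^ 0) = Matrix.gram ℂ (fun _ : ι => (1 : ℂ)) := by
        ext i j
        simp [Matrix.gram_apply]
      rw [this]
      exact Matrix.posSemidef_gram ℂ (fun _ : ι => (1 : ℂ))
    | succ n ih =>
      have : (Matrix.of fun i j => ⟪v i, v j⟫_ℂ ^ (n + 1)) =
          (Matrix.of fun i j => ⟪v i, v j⟫_ℂ ^ n) ⊙ Matrix.gram ℂ v := by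
        ext i j
        simp [Matrix.gram_apply, pow_succ]
      rw [this]
      exact ih.hadamard (Matrix.posSemidef_gram ℂ v)
  refine Matrix.PosSemidef.of_dotProduct_mulVec_nonneg ?_ fun x => ?_
  · ext i j
    simp [← Complex.exp_conj]
  · have hs : HasSum (fun n : ℕ => ((n.factorial : ℂ))⁻¹ *
        (star x ⬝ᵥ (Matrix.of fun i j => ⟪v i, v j⟫_ℂ ^ n) *ᵥ x))
        (star x ⬝ᵥ (Matrix.of fun i j => Complex.exp ⟪v i, v j⟫_ℂ) *ᵥ x) := by
      simp only [dotProduct, mulVec, Finset.mul_sum, Matrix.of_apply]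
      refine hasSum_sum fun i _ => hasSum_sum fun j _ => ?_
      have h := NormedSpace.expSeries_div_hasSum_exp (𝔸 := ℂ) ⟪v i, v j⟫_ℂ
      rw [← Complex.exp_eq_exp_ℂ] at h
      refine ((h.mul_right (x j)).mul_left (star x i)).congr_fun ?_
      intro n
      ring
    refine hs.nonneg fun n => mul_nonneg ?_ ((hpow n).dotProduct_mulVec_nonneg x)
    rw [← Complex.ofReal_natCast, ← Complex.ofReal_inv]
    exact Complex.zero_le_real.2 (by positivity)

instance expKernel_posSemidef : Fact (expKernel H).PosSemidef := ⟨by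
  classical
  have htf := RKHS.posSemidef_tfae (K := expKernel H)
  have h02 := htf.out 0 2
  refine h02.2 ⟨?_, fun vv => ?_⟩
  · refine Matrix.IsHermitian.ext fun f g => ?_
    simp only [expKernel, Matrix.of_apply, star_smul]
    congr 1
    · simp [← Complex.exp_conj]
    · exact star_one (ℂ →L[ℂ] ℂ)
  · have h := (exp_gram_posSemidef H (fun i : vv.support => (i : H))).dotProduct_mulVec_nonneg
      (fun i => vv i)
    have key : (vv.sum fun x w => vv.sum fun x' w' => ⟪(expKernel H x' x) w, w'⟫_ℂ) =
        star (fun i : vv.support => vv i) ⬝ᵥ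
          (Matrix.of fun i j : vv.support => Complex.exp ⟪(i : H), (j : H)⟫_ℂ) *ᵥ
            (fun i : vv.support => vv i) := by
      simp only [Finsupp.sum, expKernel, dotProduct, mulVec, Matrix.of_apply]
      rw [← Finset.sum_coe_sort vv.support]
      refine Finset.sum_congr rfl fun i _ => ?_
      rw [← Finset.sum_coe_sort vv.support, Finset.mul_sum]
      refine Finset.sum_congr rfl fun j _ => ?_
      simp [← Complex.exp_conj]
      ring
    rw [key]
    exact (Complex.nonneg_iff.1 h).1⟩

/-- The Boson (symmetric) Fock space over `H`, realised as the reproducing kernel Hilbert space of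
the kernel `(f, g) ↦ exp ⟪f, g⟫`. It is spanned, up to closure, by the exponential vectors `e(f)`,
and `⟪e(f), e(g)⟫ = exp ⟪f, g⟫`; this determines it, and the `e(f)`, up to a unique unitary. -/
def BosonFock : Type _ := RKHS.OfKernel (expKernel H)

namespace BosonFock

noncomputable instance : NormedAddCommGroup (BosonFock H) :=
  inferInstanceAs (NormedAddCommGroup (RKHS.OfKernel (expKernel H)))
noncomputable instance : InnerProductSpace ℂ (BosonFock H) :=
  inferInstanceAs (InnerProductSpace ℂ (RKHS.OfKernel (expKernel H)))
instance : CompleteSpace (BosonFock H) :=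
  inferInstanceAs (CompleteSpace (RKHS.OfKernel (expKernel H)))
noncomputable instance : RKHS ℂ (BosonFock H) H ℂ :=
  inferInstanceAs (RKHS ℂ (RKHS.OfKernel (expKernel H)) H ℂ)

variable {H}

/-- The exponential vector `e(f)`. -/
noncomputable def expVec (f : H) : BosonFock H := RKHS.kerFun (BosonFock H) f (1 : ℂ)

theorem inner_expVec (f g : H) : ⟪expVec f, expVec g⟫_ℂ = Complex.exp ⟪f, g⟫_ℂ := by
  have hk : RKHS.kernel (BosonFock H) = expKernel H := RKHS.OfKernel.kernel_ofKernel
  rw [expVec, expVec, ← RKHS.kernel_inner, hk]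
  simp [expKernel, ← Complex.exp_conj]

theorem isTotal_expVec : IsTotal (expVec (H := H)) := by
  rw [IsTotal]
  rw [← RKHS.kerFun_dense (BosonFock H)]
  congr 1
  apply le_antisymm <;> rw [Submodule.span_le]
  · rintro _ ⟨f, rfl⟩
    exact Submodule.subset_span ⟨f, 1, rfl⟩
  · rintro _ ⟨f, c, rfl⟩
    have : RKHS.kerFun (BosonFock H) f c = c • expVec f := by
      rw [expVec, ← map_smul]; simp
    rw [SetLike.mem_coe, this]
    exact Submodule.smul_mem _ _ (Submodule.subset_span ⟨f, rfl⟩)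

end BosonFock

end BosonFock

section Ultraweak

variable {H K : Type*} [NormedAddCommGroup H] [InnerProductSpace ℂ H]
  [NormedAddCommGroup K] [InnerProductSpace ℂ K]

theorem summable_inner_apply (u v : lp (fun _ : ℕ => H) 2) (T : H →L[ℂ] H) :
    Summable fun n => ⟪u n, T (v n)⟫_ℂ := by
  have hu := (lp.memℓp u).summable (by norm_num)
  have hv := (lp.memℓp v).summable (by norm_num)
  refine Summable.of_norm_bounded ((hu.add hv).mul_left ‖T‖) fun n => ?_
  refine (norm_inner_le_norm _ _).trans ?_
  have h1 := T.le_opNorm (v n)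
  have h2 := norm_nonneg T
  have h3 := norm_nonneg (u n)
  have h4 := norm_nonneg (v n)
  simp only [ENNReal.toReal_ofNat, Real.rpow_ofNat]
  have h5 : ‖u n‖ * ‖v n‖ ≤ ‖u n‖ ^ 2 + ‖v n‖ ^ 2 := by
    nlinarith [sq_nonneg (‖u n‖ - ‖v n‖), sq_nonneg (‖u n‖ + ‖v n‖)]
  calc ‖u n‖ * ‖T (v n)‖ ≤ ‖u n‖ * (‖T‖ * ‖v n‖) := by gcongr
    _ = ‖T‖ * (‖u n‖ * ‖v n‖) := by ring
    _ ≤ _ := by gcongr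

/-- The normal functional `T ↦ ∑ ⟪uₙ, T vₙ⟫` given by two square-summable sequences. -/
noncomputable def vecFunctional (u v : lp (fun _ : ℕ => H) 2) : (H →L[ℂ] H) →ₗ[ℂ] ℂ where
  toFun T := ∑' n, ⟪u n, T (v n)⟫_ℂ
  map_add' S T := by
    rw [← (summable_inner_apply u v S).tsum_add (summable_inner_apply u v T)]
    simp
  map_smul' c T := by
    simp [tsum_mul_left]

variable (H) in
/-- The ultraweak (σ-weak) topology on the bounded operators on `H`: the coarsest one for which the
functionals `T ↦ ∑ ⟪uₙ, T vₙ⟫`, with `u` and `v` in `ℓ²(ℕ; H)`, are continuous. -/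
@[reducible] noncomputable def ultraweak : TopologicalSpace (H →L[ℂ] H) :=
  ⨅ (u : lp (fun _ : ℕ => H) 2) (v : lp (fun _ : ℕ => H) 2),
    TopologicalSpace.induced (vecFunctional u v) inferInstance

theorem ultraweak_continuousAdd : @ContinuousAdd (H →L[ℂ] H) (ultraweak H) _ := by
  refine continuousAdd_iInf fun u => continuousAdd_iInf fun v => ?_
  exact continuousAdd_induced (vecFunctional u v)

theorem ultraweak_continuousSMul :
    @ContinuousSMul ℂ (H →L[ℂ] H) _ _ (ultraweak H) := by
  refine continuousSMul_iInf fun u => continuousSMul_iInf fun v => ?_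
  exact continuousSMul_induced (vecFunctional u v)

theorem continuous_ultraweak_iff {X : Type*} [tX : TopologicalSpace X] {f : X → (H →L[ℂ] H)} :
    Continuous[tX, ultraweak H] f ↔
      ∀ u v : lp (fun _ : ℕ => H) 2, Continuous fun x => vecFunctional u v (f x) := by
  unfold ultraweak
  rw [continuous_iInf_rng]
  refine forall_congr' fun u => ?_
  rw [continuous_iInf_rng]
  exact forall_congr' fun v => continuous_induced_rng

theorem continuous_vecFunctional (u v : lp (fun _ : ℕ => H) 2) :
    Continuous[ultraweak H, inferInstance] (vecFunctional u v) :=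
  (@continuous_ultraweak_iff H _ _ _ (ultraweak H) id).1
    (@continuous_id _ (ultraweak H)) u v

theorem continuous_inner_apply (x y : H) :
    Continuous[ultraweak H, inferInstance] fun T : H →L[ℂ] H => ⟪x, T y⟫_ℂ := by
  have h := continuous_vecFunctional (lp.single 2 0 x) (lp.single 2 0 y)
  convert h using 2 with T
  change _ = ∑' n, _
  rw [tsum_eq_single 0]
  · simp
  · intro n hn
    simp [hn]

theorem ultraweak_t2 : @T2Space (H →L[ℂ] H) (ultraweak H) := by
  let _ := ultraweak H
  refine ⟨fun S T hST => ?_⟩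
  obtain ⟨y, hy⟩ : ∃ y, S y ≠ T y := by
    by_contra! h
    exact hST (ContinuousLinearMap.ext h)
  obtain ⟨x, hx⟩ : ∃ x, ⟪x, S y⟫_ℂ ≠ ⟪x, T y⟫_ℂ := by
    by_contra! h
    exact hy (ext_inner_left ℂ h)
  exact separated_by_continuous (continuous_inner_apply x y) hx

/-- The ultraweak closure of a space of operators. -/
noncomputable def uwClosure (S : Submodule ℂ (H →L[ℂ] H)) : Submodule ℂ (H →L[ℂ] H) where
  carrier := closure[ultraweak H] (S : Set (H →L[ℂ] H))
  zero_mem' := by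
    let _ := ultraweak H
    exact subset_closure S.zero_mem
  add_mem' := by
    let _ := ultraweak H
    have := ultraweak_continuousAdd (H := H)
    have := ultraweak_continuousSMul (H := H)
    exact fun {_ _} ha hb => S.topologicalClosure.add_mem ha hb
  smul_mem' := by
    let _ := ultraweak H
    have := ultraweak_continuousAdd (H := H)
    have := ultraweak_continuousSMul (H := H)
    exact fun c _ ha => S.topologicalClosure.smul_mem c ha

/-- The relative ultraweak topology on a space of operators. -/
@[reducible] noncomputable def ultraweakOn (S : Submodule ℂ (H →L[ℂ] H)) : TopologicalSpace S :=
  (ultraweak H).induced Subtype.val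

/-- A linear map between spaces of operators is normal if it is ultraweakly continuous. -/
noncomputable def IsNormal {S : Submodule ℂ (H →L[ℂ] H)} {R : Submodule ℂ (K →L[ℂ] K)} (φ : S →ₗ[ℂ] R) : Prop :=
  Continuous[ultraweakOn S, ultraweakOn R] φ

/-- The operator on `Hⁿ` (Hilbert direct sum) given by an `n × n` matrix of operators on `H`. -/
noncomputable def matOp {n : ℕ} (a : Matrix (Fin n) (Fin n) (H →L[ℂ] H)) :
    PiLp 2 (fun _ : Fin n => H) →L[ℂ] PiLp 2 (fun _ : Fin n => H) :=
  (PiLp.continuousLinearEquiv 2 ℂ (fun _ : Fin n => H)).symm.toContinuousLinearMap ∘L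
    ContinuousLinearMap.pi fun i => ∑ j, a i j ∘L PiLp.proj 2 (fun _ : Fin n => H) j

theorem matOp_apply {n : ℕ} (a : Matrix (Fin n) (Fin n) (H →L[ℂ] H))
    (x : PiLp 2 (fun _ : Fin n => H)) (i : Fin n) : matOp a x i = ∑ j, a i j (x j) := by
  simp [matOp]

/-- Complete boundedness: the amplifications to `n × n` matrices are bounded, uniformly in `n`. -/
noncomputable def IsCompletelyBounded {S : Submodule ℂ (H →L[ℂ] H)} {R : Submodule ℂ (K →L[ℂ] K)}
    (φ : S →ₗ[ℂ] R) : Prop :=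
  ∃ C : ℝ, ∀ (n : ℕ) (a : Matrix (Fin n) (Fin n) S),
    ‖matOp (Matrix.of fun i j => (φ (a i j) : K →L[ℂ] K))‖ ≤
      C * ‖matOp (Matrix.of fun i j => (a i j : H →L[ℂ] H))‖

variable [CompleteSpace H] [CompleteSpace K]

/-- The compression `T ↦ V† T V`. -/
noncomputable def compress (V : H →L[ℂ] K) : (K →L[ℂ] K) →ₗ[ℂ] (H →L[ℂ] H) where
  toFun T := ContinuousLinearMap.adjoint V ∘L T ∘L V
  map_add' S T := by ext; simp
  map_smul' c T := by ext; simp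

theorem inner_compress (V : H →L[ℂ] K) (T : K →L[ℂ] K) (x y : H) :
    ⟪x, compress V T y⟫_ℂ = ⟪V x, T (V y)⟫_ℂ := by
  simp [compress, ContinuousLinearMap.adjoint_inner_right]

theorem continuous_compress (V : H →L[ℂ] K) :
    Continuous[ultraweak K, ultraweak H] (compress V) := by
  have hmem : ∀ u : lp (fun _ : ℕ => H) 2, Memℓp (fun n => V (u n)) 2 := by
    intro u
    have hu := (lp.memℓp u).summable (by norm_num)
    refine memℓp_gen (Summable.of_nonneg_of_le (fun n => by positivity) (fun n => ?_)
      (hu.mul_left (‖V‖ ^ 2)))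
    simp only [ENNReal.toReal_ofNat, Real.rpow_ofNat]
    rw [← mul_pow]
    gcongr
    exact V.le_opNorm _
  refine (@continuous_ultraweak_iff H _ _ _ (ultraweak K) (compress V)).2 fun u v => ?_
  have h := continuous_vecFunctional (⟨_, hmem u⟩ : lp (fun _ : ℕ => K) 2) ⟨_, hmem v⟩
  convert h using 2 with T
  change ∑' n, _ = ∑' n, _
  simp only [inner_compress]

/-- The elements of a von Neumann algebra, as a space of operators. -/
noncomputable def opSpace (A : VonNeumannAlgebra H) : Submodule ℂ (H →L[ℂ] H) :=
  A.toStarSubalgebra.toSubalgebra.toSubmodule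

theorem mem_opSpace {A : VonNeumannAlgebra H} {a : H →L[ℂ] H} : a ∈ opSpace A ↔ a ∈ A := Iff.rfl

theorem isClosed_opSpace (A : VonNeumannAlgebra H) :
    IsClosed[ultraweak H] (opSpace A : Set (H →L[ℂ] H)) := by
  let _ := ultraweak H
  have h : (opSpace A : Set (H →L[ℂ] H)) =
      ⋂ b ∈ A.commutant, ⋂ (x : H), ⋂ (y : H),
        {T : H →L[ℂ] H | ⟪ContinuousLinearMap.adjoint b x, T y⟫_ℂ = ⟪x, T (b y)⟫_ℂ} := by
    ext T
    have h1 : T ∈ (opSpace A : Set (H →L[ℂ] H)) ↔ ∀ b ∈ A.commutant, b * T = T * b := by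
      rw [← VonNeumannAlgebra.mem_commutant_iff, VonNeumannAlgebra.commutant_commutant]
      rfl
    rw [h1]
    simp only [Set.mem_iInter, Set.mem_ofPred_eq, ContinuousLinearMap.adjoint_inner_left]
    refine forall₂_congr fun b _ => ⟨fun hb x y => ?_, fun hb => ?_⟩
    · exact congrArg (fun S : H →L[ℂ] H => ⟪x, S y⟫_ℂ) hb
    · ext y
      exact ext_inner_left ℂ fun x => hb x y
  rw [h]
  refine isClosed_biInter fun b _ => isClosed_iInter fun x => isClosed_iInter fun y => ?_
  exact isClosed_eq (continuous_inner_apply _ _) (continuous_inner_apply _ _)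

theorem compress_mem_uwClosure (V : H →L[ℂ] K) {S : Submodule ℂ (K →L[ℂ] K)}
    {R : Submodule ℂ (H →L[ℂ] H)} (h : ∀ T ∈ S, compress V T ∈ R) {T : K →L[ℂ] K}
    (hT : T ∈ uwClosure S) : compress V T ∈ uwClosure R := by
  let _ := ultraweak H
  let _ := ultraweak K
  exact map_mem_closure (continuous_compress V) hT h

end Ultraweak

section UWTensor

variable {H K H' K' : Type*} [NormedAddCommGroup H] [InnerProductSpace ℂ H] [CompleteSpace H]
  [NormedAddCommGroup K] [InnerProductSpace ℂ K] [CompleteSpace K]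
  [NormedAddCommGroup H'] [InnerProductSpace ℂ H'] [CompleteSpace H']
  [NormedAddCommGroup K'] [InnerProductSpace ℂ K'] [CompleteSpace K']

theorem HTensor.adjoint_map (a : H →L[ℂ] H') (b : K →L[ℂ] K') :
    ContinuousLinearMap.adjoint (HTensor.map a b) =
      HTensor.map (ContinuousLinearMap.adjoint a) (ContinuousLinearMap.adjoint b) := by
  refine HTensor.ext_tmul fun u x => ?_
  refine (innerSL_inj (𝕜 := ℂ)).1 (HTensor.ext_tmul fun u' x' => ?_)
  simp [ContinuousLinearMap.adjoint_inner_left, HTensor.map_tmul, HTensor.inner_tmul]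

/-- The algebraic tensor product of `A` and `B(K)`: the span of the operators `a ⊗ b`. -/
noncomputable def algTensor (A : VonNeumannAlgebra H) (K : Type*) [NormedAddCommGroup K] [InnerProductSpace ℂ K] :
    Submodule ℂ (HTensor H K →L[ℂ] HTensor H K) :=
  Submodule.span ℂ {T | ∃ a ∈ A, ∃ b : K →L[ℂ] K, T = HTensor.map a b}

/-- The ultraweak tensor product of `A` and `B(K)`: the ultraweak closure of the algebraic one. -/
noncomputable def uwTensor (A : VonNeumannAlgebra H) (K : Type*) [NormedAddCommGroup K] [InnerProductSpace ℂ K] :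
    Submodule ℂ (HTensor H K →L[ℂ] HTensor H K) :=
  uwClosure (algTensor A K)

theorem map_mem_uwTensor {A : VonNeumannAlgebra H} {a : H →L[ℂ] H} (ha : a ∈ A) (b : K →L[ℂ] K) :
    HTensor.map a b ∈ uwTensor A K := by
  let _ := ultraweak (HTensor H K)
  exact subset_closure (Submodule.subset_span ⟨a, ha, b, rfl⟩)

theorem compress_E_map (x : K) (a : H →L[ℂ] H) (b : K →L[ℂ] K) :
    compress (HTensor.E H x) (HTensor.map a b) = ⟪x, b x⟫_ℂ • a := by
  ext u
  refine ext_inner_left ℂ fun w => ?_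
  rw [inner_compress]
  simp [HTensor.E_apply, HTensor.map_tmul, HTensor.inner_tmul, inner_smul_right, mul_comm]

theorem compress_one_map (V : K' →L[ℂ] K) (a : H →L[ℂ] H) (b : K →L[ℂ] K) :
    compress (HTensor.map (ContinuousLinearMap.id ℂ H) V) (HTensor.map a b) =
      HTensor.map a (compress V b) := by
  refine HTensor.ext_tmul fun u x => ?_
  have h1 : ContinuousLinearMap.adjoint (ContinuousLinearMap.id ℂ H) = ContinuousLinearMap.id ℂ H :=
    ContinuousLinearMap.adjoint_id
  simp [compress, HTensor.adjoint_map, HTensor.map_tmul, h1]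

theorem compress_E_mem (A : VonNeumannAlgebra H) (x : K) {T : HTensor H K →L[ℂ] HTensor H K}
    (hT : T ∈ uwTensor A K) : compress (HTensor.E H x) T ∈ opSpace A := by
  have h : compress (HTensor.E H x) T ∈ uwClosure (opSpace A) := by
    refine compress_mem_uwClosure _ (S := algTensor A K) ?_ hT
    intro T hT
    induction hT using Submodule.span_induction with
    | mem T hT =>
      obtain ⟨a, ha, b, rfl⟩ := hT
      rw [compress_E_map]
      exact Submodule.smul_mem _ _ ha
    | zero => rw [map_zero]; exact Submodule.zero_mem _
    | add S T _ _ hS hT => rw [map_add]; exact Submodule.add_mem _ hS hT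
    | smul c T _ hT => rw [map_smul]; exact Submodule.smul_mem _ _ hT
  let _ := ultraweak H
  have hc := (isClosed_opSpace A).closure_eq
  change _ ∈ closure (opSpace A : Set (H →L[ℂ] H)) at h
  rw [hc] at h
  exact h

theorem compress_one_mem (A : VonNeumannAlgebra H) (V : K' →L[ℂ] K)
    {T : HTensor H K →L[ℂ] HTensor H K} (hT : T ∈ uwTensor A K) :
    compress (HTensor.map (ContinuousLinearMap.id ℂ H) V) T ∈ uwTensor A K' := by
  refine compress_mem_uwClosure _ (S := algTensor A K) ?_ hT
  intro T hT
  induction hT using Submodule.span_induction with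
  | mem T hT =>
    obtain ⟨a, ha, b, rfl⟩ := hT
    rw [compress_one_map]
    exact Submodule.subset_span ⟨a, ha, _, rfl⟩
  | zero => rw [map_zero]; exact Submodule.zero_mem _
  | add S T _ _ hS hT => rw [map_add]; exact Submodule.add_mem _ hS hT
  | smul c T _ hT => rw [map_smul]; exact Submodule.smul_mem _ _ hT

/-- The slice map `id ⊗ ω_x : A ⊗ B(K) → A`, `T ↦ E_x† T E_x`, where `ω_x` is the vector
functional `b ↦ ⟪x, b x⟫`. -/
noncomputable def slice (A : VonNeumannAlgebra H) (x : K) : uwTensor A K →ₗ[ℂ] opSpace A :=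
  ((compress (HTensor.E H x)).comp (uwTensor A K).subtype).codRestrict (opSpace A)
    fun T => compress_E_mem A x T.2

theorem slice_map (A : VonNeumannAlgebra H) (x : K) {a : H →L[ℂ] H} (ha : a ∈ A) (b : K →L[ℂ] K) :
    slice A x ⟨HTensor.map a b, map_mem_uwTensor ha b⟩ = ⟪x, b x⟫_ℂ • (⟨a, ha⟩ : opSpace A) :=
  Subtype.ext (compress_E_map x a b)

/-- Ultraweakly continuous linear maps which agree on the operators `a ⊗ b` are equal. -/
theorem uwTensor_ext {A : VonNeumannAlgebra H} {Φ Ψ : uwTensor A K →ₗ[ℂ] (H' →L[ℂ] H')}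
    (hΦ : Continuous[ultraweakOn (uwTensor A K), ultraweak H'] Φ)
    (hΨ : Continuous[ultraweakOn (uwTensor A K), ultraweak H'] Ψ)
    (h : ∀ (a : opSpace A) (b : K →L[ℂ] K),
      Φ ⟨HTensor.map a b, map_mem_uwTensor a.2 b⟩ =
        Ψ ⟨HTensor.map a b, map_mem_uwTensor a.2 b⟩) : Φ = Ψ := by
  let _ := ultraweak (HTensor H K)
  let _ := ultraweak H'
  have := ultraweak_t2 (H := H')
  have hcl : IsClosed[ultraweakOn (uwTensor A K)] {T : uwTensor A K | Φ T = Ψ T} :=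
    @isClosed_eq _ _ _ (ultraweakOn (uwTensor A K)) _ _ _ hΦ hΨ
  obtain ⟨C, hC, hCe⟩ := isClosed_induced_iff.1 hcl
  have hsub : (algTensor A K : Set _) ⊆ C := by
    intro T hT
    have hT' : T ∈ uwTensor A K := subset_closure hT
    have : (⟨T, hT'⟩ : uwTensor A K) ∈ {T : uwTensor A K | Φ T = Ψ T} := by
      simp only [Set.mem_ofPred_eq]
      induction hT using Submodule.span_induction with
      | mem T hT =>
        obtain ⟨a, ha, b, rfl⟩ := hT
        exact h ⟨a, ha⟩ b
      | zero => exact (map_zero Φ).trans (map_zero Ψ).symm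
      | add S T hS hT h1 h2 =>
        have h3 := congrArg₂ (· + ·) (h1 (subset_closure hS)) (h2 (subset_closure hT))
        simp only [← map_add] at h3
        exact h3
      | smul c T hT h1 =>
        have h3 := congrArg (c • ·) (h1 (subset_closure hT))
        simp only [← map_smul] at h3
        exact h3
    rw [← hCe] at this
    exact this
  ext1 T
  have hT : (T : HTensor H K →L[ℂ] HTensor H K) ∈ C := closure_minimal hsub hC T.2
  have : T ∈ Subtype.val ⁻¹' C := hT
  rw [hCe] at this
  exact this

/-- `Φ` is the ultraweak tensor product `φ ⊗ id` of `φ` with the identity map on `B(K)`: the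
ultraweakly continuous linear map with `a ⊗ b ↦ φ a ⊗ b`. -/
structure IsTensorId {A : VonNeumannAlgebra H} (φ : opSpace A →ₗ[ℂ] (H' →L[ℂ] H'))
    (Φ : uwTensor A K →ₗ[ℂ] (HTensor H' K →L[ℂ] HTensor H' K)) : Prop where
  normal : Continuous[ultraweakOn (uwTensor A K), ultraweak (HTensor H' K)] Φ
  map_tmul : ∀ (a : opSpace A) (b : K →L[ℂ] K),
    Φ ⟨HTensor.map a b, map_mem_uwTensor a.2 b⟩ = HTensor.map (φ a) b

theorem IsTensorId.unique {A : VonNeumannAlgebra H} {φ : opSpace A →ₗ[ℂ] (H' →L[ℂ] H')}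
    {Φ Ψ : uwTensor A K →ₗ[ℂ] (HTensor H' K →L[ℂ] HTensor H' K)}
    (hΦ : IsTensorId φ Φ) (hΨ : IsTensorId φ Ψ) : Φ = Ψ :=
  uwTensor_ext hΦ.normal hΨ.normal fun a b => (hΦ.map_tmul a b).trans (hΨ.map_tmul a b).symm

open Classical in
/-- The ultraweak tensor product `φ ⊗ id : A ⊗ B(K) → B(H' ⊗ K)` of `φ : A → B(H')` with the
identity map on `B(K)`. There is at most one such map (`IsTensorId.unique`), and there is one for
every normal completely bounded `φ`; where there is none, the value is `0`. -/
noncomputable def tensorId (K : Type*) [NormedAddCommGroup K] [InnerProductSpace ℂ K]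
    [CompleteSpace K] {A : VonNeumannAlgebra H} (φ : opSpace A →ₗ[ℂ] (H' →L[ℂ] H')) :
    uwTensor A K →ₗ[ℂ] (HTensor H' K →L[ℂ] HTensor H' K) :=
  if h : ∃ Φ : uwTensor A K →ₗ[ℂ] (HTensor H' K →L[ℂ] HTensor H' K), IsTensorId φ Φ
  then h.choose else 0

end UWTensor

section Fock

open MeasureTheory Set

variable (M : Type*) [NormedAddCommGroup M] [InnerProductSpace ℂ M]

/-- The Hilbert space `L²(J; M)`. -/
noncomputable abbrev L2 (J : Set ℝ) : Type _ := Lp M 2 (volume.restrict J)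

variable {M}

/-- The restriction to `J` of an element of `L²(J'; M)`, where `J ⊆ J'`. -/
noncomputable def restrictL2 {J J' : Set ℝ} (hJ : J ⊆ J') (f : L2 M J') : L2 M J :=
  ((Lp.memLp f).mono_measure (Measure.restrict_mono hJ le_rfl)).toLp f

theorem coeFn_restrictL2 {J J' : Set ℝ} (hJ : J ⊆ J') (f : L2 M J') :
    restrictL2 hJ f =ᵐ[volume.restrict J] f := MemLp.coeFn_toLp _

theorem inner_restrictL2 {J J' : Set ℝ} (hJ : J ⊆ J') (f g : L2 M J') :
    ⟪restrictL2 hJ f, restrictL2 hJ g⟫_ℂ = ∫ x in J, ⟪f x, g x⟫_ℂ := by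
  rw [L2.inner_def]
  refine integral_congr_ae ?_
  filter_upwards [coeFn_restrictL2 hJ f, coeFn_restrictL2 hJ g] with x h1 h2
  rw [h1, h2]

theorem Ico_subset_Ici_zero (t : ℝ≥0) : Ico (0 : ℝ) t ⊆ Ici 0 := Ico_subset_Ici_self

theorem Ici_subset_Ici_zero (t : ℝ≥0) : Ici (t : ℝ) ⊆ Ici 0 := Ici_subset_Ici.2 t.2

/-- The restriction of `f` to `[0, t)`. -/
noncomputable def before (t : ℝ≥0) (f : L2 M (Ici 0)) : L2 M (Ico 0 t) :=
  restrictL2 (Ico_subset_Ici_zero t) f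

/-- The restriction of `f` to `[t, ∞)`. -/
noncomputable def after (t : ℝ≥0) (f : L2 M (Ici 0)) : L2 M (Ici t) :=
  restrictL2 (Ici_subset_Ici_zero t) f

theorem inner_before_add_inner_after (t : ℝ≥0) (f g : L2 M (Ici 0)) :
    ⟪before t f, before t g⟫_ℂ + ⟪after t f, after t g⟫_ℂ = ⟪f, g⟫_ℂ := by
  rw [before, before, after, after, inner_restrictL2, inner_restrictL2, L2.inner_def]
  have key : ∀ F : ℝ → ℂ, IntegrableOn F (Ici (0 : ℝ)) →
      (∫ x in Ico (0 : ℝ) t, F x) + ∫ x in Ici (t : ℝ), F x = ∫ x in Ici (0 : ℝ), F x := by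
    intro F hF
    rw [← Ico_union_Ici_eq_Ici t.2] at hF ⊢
    refine (setIntegral_union ?_ measurableSet_Ici hF.left_of_union hF.right_of_union).symm
    exact Set.disjoint_left.2 fun x hx hx' => not_lt.2 hx' hx.2
  exact key _ (L2.integrable_inner f g)

theorem exists_before_after (t : ℝ≥0) (f : L2 M (Ico 0 (t : ℝ))) (g : L2 M (Ici (t : ℝ))) :
    ∃ p : L2 M (Ici 0), before t p = f ∧ after t p = g := by
  have hf : MemLp ((Ico (0 : ℝ) t).indicator f) 2 (volume.restrict (Ici 0)) := by
    refine MemLp.mono_measure Measure.restrict_le_self ?_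
    exact (memLp_indicator_iff_restrict measurableSet_Ico).2 (Lp.memLp f)
  have hg : MemLp ((Ici (t : ℝ)).indicator g) 2 (volume.restrict (Ici 0)) := by
    refine MemLp.mono_measure Measure.restrict_le_self ?_
    exact (memLp_indicator_iff_restrict measurableSet_Ici).2 (Lp.memLp g)
  refine ⟨(hf.add hg).toLp _, ?_, ?_⟩
  · refine Lp.ext ?_
    have h := (hf.add hg).coeFn_toLp
    filter_upwards [coeFn_restrictL2 (Ico_subset_Ici_zero t) ((hf.add hg).toLp _),
      ae_restrict_of_ae_restrict_of_subset (Ico_subset_Ici_zero t) h,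
      ae_restrict_mem measurableSet_Ico] with x h1 h2 h3
    rw [before, h1, h2]
    have h4 : x ∉ Ici (t : ℝ) := not_le.2 h3.2
    simp [Set.indicator_of_mem h3, Set.indicator_of_notMem h4]
  · refine Lp.ext ?_
    have h := (hf.add hg).coeFn_toLp
    filter_upwards [coeFn_restrictL2 (Ici_subset_Ici_zero t) ((hf.add hg).toLp _),
      ae_restrict_of_ae_restrict_of_subset (Ici_subset_Ici_zero t) h,
      ae_restrict_mem measurableSet_Ici] with x h1 h2 h3
    rw [after, h1, h2]
    have h4 : x ∉ Ico (0 : ℝ) t := fun hx => not_lt.2 h3 hx.2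
    simp [Set.indicator_of_mem h3, Set.indicator_of_notMem h4]

theorem measurePreserving_sub_const (t : ℝ) :
    MeasurePreserving (fun x : ℝ => x - t) (volume.restrict (Ici t)) (volume.restrict (Ici 0)) := by
  have h := (measurePreserving_sub_right (volume : Measure ℝ) t).restrict_preimage
    (measurableSet_Ici (a := (0 : ℝ)))
  convert h using 2
  ext x
  simp

/-- The right shift `f ↦ f(· - t)`, from `L²(ℝ₊; M)` to `L²([t, ∞); M)`. -/
noncomputable def rightShift (t : ℝ≥0) : L2 M (Ici 0) →ₗᵢ[ℂ] L2 M (Ici (t : ℝ)) :=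
  Lp.compMeasurePreservingₗᵢ ℂ (fun x : ℝ => x - t) (measurePreserving_sub_const t)

variable (M) in
/-- The Boson Fock space over `L²(J; M)`. -/
noncomputable abbrev Fock (J : Set ℝ) : Type _ := BosonFock (L2 M J)

variable (M) in
/-- The vacuum vector of the Boson Fock space over `L²(J; M)`. -/
noncomputable def vacuum (J : Set ℝ) : Fock M J := BosonFock.expVec 0

variable (M) in
/-- The projection `|Ω⟩⟨Ω|` onto the vacuum vector. -/
noncomputable def vacuumProj (J : Set ℝ) : Fock M J →L[ℂ] Fock M J :=
  InnerProductSpace.rankOne ℂ (vacuum M J) (vacuum M J)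

variable (M) in
/-- The second quantisation `S_t` of the right shift, the isometry with `e(f) ↦ e(f(· - t))`. -/
noncomputable def shiftFock (t : ℝ≥0) : Fock M (Ici 0) →ₗᵢ[ℂ] Fock M (Ici (t : ℝ)) :=
  gramIsometry BosonFock.expVec (fun f => BosonFock.expVec (rightShift t f))
    BosonFock.isTotal_expVec fun f g => by
      rw [BosonFock.inner_expVec, BosonFock.inner_expVec, LinearIsometry.inner_map_map]

theorem shiftFock_expVec (t : ℝ≥0) (f : L2 M (Ici 0)) :
    shiftFock M t (BosonFock.expVec f) = BosonFock.expVec (rightShift t f) :=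
  gramIsometry_apply _ _ _ _ f

variable (H : Type*) [NormedAddCommGroup H] [InnerProductSpace ℂ H]

theorem isTotal_id : IsTotal (fun u : H => u) := by
  rw [IsTotal]
  simp only [range_id', Submodule.span_univ]
  exact top_unique (Submodule.le_topologicalClosure _)

theorem isTotal_before_after (t : ℝ≥0) : IsTotal (fun p : H × L2 M (Ici 0) =>
    HTensor.tmul (HTensor.tmul p.1 (BosonFock.expVec (before t p.2)))
      (BosonFock.expVec (after t p.2))) := by
  have h := HTensor.isTotal_tmul_of_isTotal
    (HTensor.isTotal_tmul_of_isTotal (isTotal_id H)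
      (BosonFock.isTotal_expVec (H := L2 M (Ico 0 (t : ℝ)))))
    (BosonFock.isTotal_expVec (H := L2 M (Ici (t : ℝ))))
  refine top_unique (h.symm.le.trans (Submodule.topologicalClosure_mono (Submodule.span_mono ?_)))
  rintro _ ⟨⟨⟨u, f⟩, g⟩, rfl⟩
  obtain ⟨p, h1, h2⟩ := exists_before_after t f g
  exact ⟨(u, p), by simp only [h1, h2]⟩

theorem isTotal_tmul_expVec (J : Set ℝ) : IsTotal (fun p : H × L2 M J =>
    HTensor.tmul p.1 (BosonFock.expVec p.2)) := by
  have h := HTensor.isTotal_tmul_of_isTotal (isTotal_id H)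
    (BosonFock.isTotal_expVec (H := L2 M J))
  exact h

theorem inner_tmul_before_after (t : ℝ≥0) (p q : H × L2 M (Ici 0)) :
    ⟪HTensor.tmul p.1 (BosonFock.expVec p.2), HTensor.tmul q.1 (BosonFock.expVec q.2)⟫_ℂ =
      ⟪HTensor.tmul (HTensor.tmul p.1 (BosonFock.expVec (before t p.2)))
          (BosonFock.expVec (after t p.2)),
        HTensor.tmul (HTensor.tmul q.1 (BosonFock.expVec (before t q.2)))
          (BosonFock.expVec (after t q.2))⟫_ℂ := by
  simp only [HTensor.inner_tmul, BosonFock.inner_expVec]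
  rw [mul_assoc, ← Complex.exp_add, inner_before_add_inner_after]

variable (M) in
/-- The identification `h ⊗ F = (h ⊗ F_{[0,t)}) ⊗ F_{[t,∞)}`, the unitary with
`u ⊗ e(f) ↦ (u ⊗ e(f|_{[0,t)})) ⊗ e(f|_{[t,∞)})`. -/
noncomputable def factor (t : ℝ≥0) :
    HTensor H (Fock M (Ici 0)) ≃ₗᵢ[ℂ]
      HTensor (HTensor H (Fock M (Ico 0 (t : ℝ)))) (Fock M (Ici (t : ℝ))) :=
  gramUnitary
    (fun p : H × L2 M (Ici 0) => HTensor.tmul p.1 (BosonFock.expVec p.2))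
    (fun p : H × L2 M (Ici 0) => HTensor.tmul
      (HTensor.tmul p.1 (BosonFock.expVec (before t p.2))) (BosonFock.expVec (after t p.2)))
    (isTotal_tmul_expVec H (Ici 0)) (isTotal_before_after H t) (inner_tmul_before_after H t)

theorem factor_tmul (t : ℝ≥0) (u : H) (f : L2 M (Ici 0)) :
    factor M H t (HTensor.tmul u (BosonFock.expVec f)) =
      HTensor.tmul (HTensor.tmul u (BosonFock.expVec (before t f)))
        (BosonFock.expVec (after t f)) :=
  gramUnitary_apply _ _ _ _ _ (u, f)

variable (M) in
/-- The identification of the operators on `h ⊗ F` with those on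
`(h ⊗ F_{[0,t)}) ⊗ F_{[t,∞)}`. -/
noncomputable def factorOp (t : ℝ≥0) :
    (HTensor H (Fock M (Ici 0)) →L[ℂ] HTensor H (Fock M (Ici 0))) →ₗ[ℂ]
      (HTensor (HTensor H (Fock M (Ico 0 (t : ℝ)))) (Fock M (Ici (t : ℝ))) →L[ℂ]
        HTensor (HTensor H (Fock M (Ico 0 (t : ℝ)))) (Fock M (Ici (t : ℝ)))) where
  toFun T := (factor M H t : _ →L[ℂ] _) ∘L T ∘L ((factor M H t).symm : _ →L[ℂ] _)
  map_add' S T := by ext; simp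
  map_smul' c T := by ext; simp

end Fock

section Cocycle

open Set

variable {H M : Type*} [NormedAddCommGroup H] [InnerProductSpace ℂ H] [CompleteSpace H]
  [NormedAddCommGroup M] [InnerProductSpace ℂ M] [CompleteSpace M]

variable (M) in
/-- The shift `σ_t : A ⊗ B(F) → A ⊗ B(F_{[t,∞)})`, `T ↦ (1 ⊗ S_t) T (1 ⊗ S_t)†`. -/
noncomputable def shiftOp (A : VonNeumannAlgebra H) (t : ℝ≥0) :
    uwTensor A (Fock M (Ici 0)) →ₗ[ℂ] uwTensor A (Fock M (Ici (t : ℝ))) where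
  toFun T :=
    ⟨HTensor.map (ContinuousLinearMap.id ℂ H) (shiftFock M t).toContinuousLinearMap ∘L
      (T : HTensor H (Fock M (Ici 0)) →L[ℂ] HTensor H (Fock M (Ici 0))) ∘L
      ContinuousLinearMap.adjoint (HTensor.map (ContinuousLinearMap.id ℂ H)
        (shiftFock M t).toContinuousLinearMap), by
      have h := compress_one_mem A
        (ContinuousLinearMap.adjoint (shiftFock M t).toContinuousLinearMap) T.2
      have h1 : ContinuousLinearMap.adjoint (ContinuousLinearMap.id ℂ H) =
        ContinuousLinearMap.id ℂ H := ContinuousLinearMap.adjoint_id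
      rw [compress] at h
      simp only [LinearMap.coe_mk, AddHom.coe_mk, HTensor.adjoint_map, h1,
        ContinuousLinearMap.adjoint_adjoint] at h
      rw [HTensor.adjoint_map, h1]
      exact h⟩
  map_add' S T := by ext; simp
  map_smul' c T := by ext; simp

variable (M) in
/-- The vacuum expectation `𝔼 = id ⊗ ω_Ω : A ⊗ B(F) → A`. -/
noncomputable def vacuumExpectation (A : VonNeumannAlgebra H) :
    uwTensor A (Fock M (Ici 0)) →ₗ[ℂ] opSpace A :=
  slice A (vacuum M (Ici 0))

/-- For `φ : A → A ⊗ B(F)`, the map `a ↦ E_Ω† φ(a) E_Ω` into the operators on `h ⊗ F_{[0,t)}`,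
where `Ω` is the vacuum vector of `F_{[t,∞)}`. If `φ(a) = b ⊗ |Ω⟩⟨Ω|` then it maps `a` to `b`
(`beforePart_eq`). -/
noncomputable def beforePart {A : VonNeumannAlgebra H} (t : ℝ≥0)
    (φ : opSpace A →ₗ[ℂ] uwTensor A (Fock M (Ici 0))) :
    opSpace A →ₗ[ℂ] (HTensor H (Fock M (Ico 0 (t : ℝ))) →L[ℂ]
      HTensor H (Fock M (Ico 0 (t : ℝ)))) :=
  compress (HTensor.E _ (vacuum M (Ici (t : ℝ)))) ∘ₗ factorOp M H t ∘ₗ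
    (uwTensor A (Fock M (Ici 0))).subtype ∘ₗ φ

theorem beforePart_eq {A : VonNeumannAlgebra H} {t : ℝ≥0}
    {φ : opSpace A →ₗ[ℂ] uwTensor A (Fock M (Ici 0))} {a : opSpace A}
    {b : HTensor H (Fock M (Ico 0 (t : ℝ))) →L[ℂ] HTensor H (Fock M (Ico 0 (t : ℝ)))}
    (h : factorOp M H t (φ a) = HTensor.map b (vacuumProj M (Ici (t : ℝ)))) :
    beforePart t φ a = b := by
  have h1 : ⟪vacuum M (Ici (t : ℝ)), vacuumProj M (Ici (t : ℝ)) (vacuum M (Ici (t : ℝ)))⟫_ℂ = 1 := by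
    simp [vacuumProj, vacuum, BosonFock.inner_expVec, -inner_self_eq_norm_sq_to_K]
  change compress (HTensor.E _ (vacuum M (Ici (t : ℝ)))) (factorOp M H t (φ a)) = b
  rw [h, compress_E_map, h1, one_smul]

/-- Vacuum-adapted quantum stochastic cocycles on `A`. Here `F` is the Boson Fock space over
`L²(ℝ₊; M)`, and `F_{[0,t)}` and `F_{[t,∞)}` those over `L²([0,t); M)` and `L²([t,∞); M)`:
* `k_t : A → A ⊗ B(F)` is linear, normal and completely bounded;
* `initial`: `k_0(a) = a ⊗ |Ω⟩⟨Ω|`;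
* `adapted`: `k_t(a) = b ⊗ |Ω⟩⟨Ω|`, where `b = k_{t)}(a)` is in `A ⊗ B(F_{[0,t)})` and `Ω` is the
  vacuum vector of `F_{[t,∞)}`;
* `cocycle`: `k_{s+t} = (k_{s)} ⊗ id) ∘ σ_s ∘ k_t`;
* `continuous`: `r ↦ k_r(a)` is ultraweakly continuous. -/
structure IsVacuumAdaptedCocycle {A : VonNeumannAlgebra H}
    (k : ℝ≥0 → (opSpace A →ₗ[ℂ] uwTensor A (Fock M (Ici 0)))) : Prop where
  normal : ∀ t, IsNormal (k t)
  completelyBounded : ∀ t, IsCompletelyBounded (k t)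
  initial : ∀ a : opSpace A,
    (k 0 a : HTensor H (Fock M (Ici 0)) →L[ℂ] HTensor H (Fock M (Ici 0))) =
      HTensor.map (a : H →L[ℂ] H) (vacuumProj M (Ici 0))
  adapted : ∀ (t : ℝ≥0) (a : opSpace A), ∃ b ∈ uwTensor A (Fock M (Ico 0 (t : ℝ))),
    factorOp M H t (k t a) = HTensor.map b (vacuumProj M (Ici (t : ℝ)))
  cocycle : ∀ (s t : ℝ≥0) (a : opSpace A),
    factorOp M H s (k (s + t) a) =
      tensorId (Fock M (Ici (s : ℝ))) (beforePart s (k s)) (shiftOp M A s (k t a))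
  continuous : ∀ a : opSpace A, Continuous[inferInstance, ultraweakOn _] fun r => k r a

/-- Ultraweakly continuous one-parameter semigroups of linear maps on `A`. -/
structure IsUltraweakSemigroup {A : VonNeumannAlgebra H}
    (P : ℝ≥0 → (opSpace A →ₗ[ℂ] opSpace A)) : Prop where
  zero : P 0 = LinearMap.id
  add : ∀ s t, P (s + t) = P s ∘ₗ P t
  continuous : ∀ a : opSpace A, Continuous[inferInstance, ultraweakOn _] fun t => P t a

end Cocycle

end QS

set_option linter.unusedSectionVars false

/-! Every map involved is a compression `T ↦ V† T V` or comes from one. The vacuum expectation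
compresses by `E_Ω : u ↦ u ⊗ Ω`, and the identification of operators along a unitary compresses by
its inverse. Compressions are ultraweakly continuous, and on `n × n` matrices of operators they
multiply norms by at most `‖V‖²`, whatever `n` is (`norm_matOp_compress_le`). Hence `P_t = 𝔼 ∘ k_t`
inherits normality, complete boundedness and continuity in `t` from `k`. Also `P_0 = id`, because
`⟪Ω, |Ω⟩⟨Ω| Ω⟫ = 1`.

The semigroup law comes from applying `𝔼` to `k_{s+t} = (k_{s)} ⊗ id) ∘ σ_s ∘ k_t`. Three facts are
used. The vacuum is a product vector, `Ω = Ω_{s)} ⊗ Ω_{[s}`, so `𝔼` can be taken in two steps, over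
the future of `s` and then over its past (`compress_E_vacuum_factorOp`). The future slice passes
through `k_{s)} ⊗ id`, which acts trivially on that factor (`IsTensorId.compress_E`). The shift
carries the vacuum to the vacuum, so the future slice of `σ_s(T)` is `𝔼(T)`
(`slice_vacuum_shiftOp`). What remains is the past slice of `k_{s)}` evaluated at `P_t(a)`, and this
is `P_s(P_t(a))`.

The middle fact requires `tensorId` to be an actual tensor product map and not its default value.
The general existence theorem for normal completely bounded maps is avoided: the cocycle identity
itself excludes a harmful default (`IsVacuumAdaptedCocycle.isTensorId`). -/

namespace QS

/-! ### Compressions, slice maps and tensor products with the identity. -/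

section Ultraweak

variable {H K L : Type*} [NormedAddCommGroup H] [InnerProductSpace ℂ H] [CompleteSpace H]
  [NormedAddCommGroup K] [InnerProductSpace ℂ K] [CompleteSpace K]
  [NormedAddCommGroup L] [InnerProductSpace ℂ L] [CompleteSpace L]

theorem compress_compress (V : H →L[ℂ] K) (W : K →L[ℂ] L) (T : L →L[ℂ] L) :
    compress V (compress W T) = compress (W ∘L V) T := by
  ext y
  refine ext_inner_left ℂ fun x => ?_
  simp only [inner_compress, ContinuousLinearMap.comp_apply]

theorem norm_toLp_map_le {n : ℕ} (V : H →L[ℂ] K) (x : PiLp 2 (fun _ : Fin n => H)) :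
    ‖WithLp.toLp 2 (fun i => V (x i))‖ ≤ ‖V‖ * ‖x‖ := by
  refine le_of_sq_le_sq ?_ (by positivity)
  rw [mul_pow, PiLp.norm_sq_eq_of_L2, PiLp.norm_sq_eq_of_L2, Finset.mul_sum]
  refine Finset.sum_le_sum fun i _ => ?_
  rw [← mul_pow]
  gcongr
  exact V.le_opNorm _

/-- Compressing each entry by `V` amounts to compressing the whole matrix by the diagonal
amplification `V ⊕ ⋯ ⊕ V`. -/
theorem inner_matOp_compress {n : ℕ} (V : H →L[ℂ] K)
    (a : Matrix (Fin n) (Fin n) (K →L[ℂ] K)) (x y : PiLp 2 (fun _ : Fin n => H)) :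
    ⟪x, matOp (Matrix.of fun i j => compress V (a i j)) y⟫_ℂ =
      ⟪WithLp.toLp 2 (fun i => V (x i)), matOp a (WithLp.toLp 2 (fun i => V (y i)))⟫_ℂ := by
  simp only [PiLp.inner_apply, matOp_apply, Matrix.of_apply, inner_sum, inner_compress]

/-- The diagonal amplification of `V` has norm at most `‖V‖` for every `n`. The constant is
therefore uniform in `n`, as complete boundedness demands. -/
theorem norm_matOp_compress_le {n : ℕ} (V : H →L[ℂ] K)
    (a : Matrix (Fin n) (Fin n) (K →L[ℂ] K)) :
    ‖matOp (Matrix.of fun i j => compress V (a i j))‖ ≤ ‖V‖ ^ 2 * ‖matOp a‖ := by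
  refine ContinuousLinearMap.opNorm_le_bound _ (by positivity) fun y => ?_
  set z := matOp (Matrix.of fun i j => compress V (a i j)) y with hz
  -- Pairing `z` with itself lets the amplification of `V` act on both arguments, so its adjoint is
  -- never formed. One factor `‖z‖` is cancelled at the end, the case `‖z‖ = 0` being separate.
  have h : ‖z‖ * ‖z‖ ≤ ‖z‖ * (‖V‖ ^ 2 * ‖matOp a‖ * ‖y‖) := by
    calc ‖z‖ * ‖z‖ = ‖⟪z, z⟫_ℂ‖ := by
          rw [inner_self_eq_norm_sq_to_K]; simp [sq]
      _ = ‖⟪WithLp.toLp 2 (fun i => V (z i)), matOp a (WithLp.toLp 2 (fun i => V (y i)))⟫_ℂ‖ := by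
          conv_lhs => enter [1, 2]; rw [hz]
          rw [inner_matOp_compress]
      _ ≤ ‖WithLp.toLp 2 (fun i => V (z i))‖ * (‖matOp a‖ * ‖WithLp.toLp 2 (fun i => V (y i))‖) :=
          (norm_inner_le_norm _ _).trans (by gcongr; exact (matOp a).le_opNorm _)
      _ ≤ (‖V‖ * ‖z‖) * (‖matOp a‖ * (‖V‖ * ‖y‖)) := by
          gcongr <;> exact norm_toLp_map_le V _
      _ = _ := by ring
  rcases (norm_nonneg z).eq_or_lt with h0 | h0
  · rw [← h0]; positivity
  · exact le_of_mul_le_mul_left h h0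

theorem continuous_subtype_ultraweak (S : Submodule ℂ (H →L[ℂ] H)) :
    Continuous[ultraweakOn S, ultraweak H] S.subtype :=
  @continuous_induced_dom _ _ _ (ultraweak H)

theorem continuous_slice (A : VonNeumannAlgebra H) (x : K) :
    Continuous[ultraweakOn (uwTensor A K), ultraweakOn (opSpace A)] (slice A x) := by
  let _ := ultraweak H
  let _ := ultraweak (HTensor H K)
  exact continuous_induced_rng.2
    ((continuous_compress (HTensor.E H x)).comp (continuous_subtype_ultraweak (uwTensor A K)))

theorem IsNormal.slice_comp {A : VonNeumannAlgebra H} {S : Submodule ℂ (L →L[ℂ] L)}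
    {φ : S →ₗ[ℂ] uwTensor A K} (hφ : IsNormal φ) (x : K) : IsNormal (slice A x ∘ₗ φ) :=
  @Continuous.comp _ _ _ (ultraweakOn S) (ultraweakOn (uwTensor A K)) (ultraweakOn (opSpace A))
    φ (slice A x)
    (continuous_slice A x) hφ

theorem IsCompletelyBounded.slice_comp {A : VonNeumannAlgebra H} {S : Submodule ℂ (L →L[ℂ] L)}
    {φ : S →ₗ[ℂ] uwTensor A K} (hφ : IsCompletelyBounded φ) (x : K) :
    IsCompletelyBounded (slice A x ∘ₗ φ) := by
  obtain ⟨C, hC⟩ := hφ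
  refine ⟨‖HTensor.E H x‖ ^ 2 * C, fun n a => ?_⟩
  rw [mul_assoc]
  refine (norm_matOp_compress_le (HTensor.E H x)
    (Matrix.of fun i j => (φ (a i j) : HTensor H K →L[ℂ] HTensor H K))).trans ?_
  gcongr
  exact hC n a

theorem isTensorId_tensorId {A : VonNeumannAlgebra H} {φ : opSpace A →ₗ[ℂ] (L →L[ℂ] L)}
    (h : ∃ Φ : uwTensor A K →ₗ[ℂ] (HTensor L K →L[ℂ] HTensor L K), IsTensorId φ Φ) :
    IsTensorId φ (tensorId K φ) := by
  rw [tensorId, dif_pos h]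
  exact h.choose_spec

/-- Supplies the witness of existence in the one case where the cocycle identity cannot tell a
tensor product map from the default value of `tensorId`. -/
theorem isTensorId_zero (A : VonNeumannAlgebra H) :
    IsTensorId (0 : opSpace A →ₗ[ℂ] (L →L[ℂ] L))
      (0 : uwTensor A K →ₗ[ℂ] (HTensor L K →L[ℂ] HTensor L K)) where
  normal := @continuous_const _ _ (ultraweakOn _) (ultraweak _) 0
  map_tmul a b := by
    refine HTensor.ext_tmul fun u x => ?_
    rw [LinearMap.zero_apply, LinearMap.zero_apply, HTensor.map_tmul]
    simp [HTensor.tmul]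

/-- Slicing commutes with normal maps: `(id ⊗ ω_x) ∘ (φ ⊗ id) = φ ∘ (id ⊗ ω_x)`. -/
theorem IsTensorId.compress_E {A : VonNeumannAlgebra H} {φ : opSpace A →ₗ[ℂ] (L →L[ℂ] L)}
    {Φ : uwTensor A K →ₗ[ℂ] (HTensor L K →L[ℂ] HTensor L K)} (hΦ : IsTensorId φ Φ)
    (hφ : Continuous[ultraweakOn (opSpace A), ultraweak L] φ) (x : K) (T : uwTensor A K) :
    compress (HTensor.E L x) (Φ T) = φ (slice A x T) := by
  have h : compress (HTensor.E L x) ∘ₗ Φ = φ ∘ₗ slice A x := by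
    -- Both sides are ultraweakly continuous, the right one by normality of `φ`, so elementary
    -- operators suffice. On `a ⊗ b` each side equals `⟪x, b x⟫ • φ a`.
    refine uwTensor_ext
      (@Continuous.comp _ _ _ (ultraweakOn _) (ultraweak _) (ultraweak _) _ _
        (continuous_compress _) hΦ.normal)
      (@Continuous.comp _ _ _ (ultraweakOn (uwTensor A K)) (ultraweakOn (opSpace A)) (ultraweak L)
        (slice A x) φ hφ (continuous_slice A x)) fun a b => ?_
    rw [LinearMap.comp_apply, LinearMap.comp_apply, hΦ.map_tmul, compress_E_map, slice_map A x a.2,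
      map_smul]
  exact LinearMap.congr_fun h T

end Ultraweak

/-! ### The vacuum vector under factorization and shift. -/

section Fock

open MeasureTheory Set

variable {H M : Type*} [NormedAddCommGroup H] [InnerProductSpace ℂ H] [CompleteSpace H]
  [NormedAddCommGroup M] [InnerProductSpace ℂ M]

theorem inner_vacuumProj_vacuum (J : Set ℝ) :
    ⟪vacuum M J, vacuumProj M J (vacuum M J)⟫_ℂ = 1 := by
  simp [vacuumProj, vacuum, BosonFock.inner_expVec, -inner_self_eq_norm_sq_to_K]

theorem restrictL2_zero {J J' : Set ℝ} (hJ : J ⊆ J') : restrictL2 hJ (0 : L2 M J') = 0 := by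
  refine Lp.ext ?_
  filter_upwards [coeFn_restrictL2 hJ (0 : L2 M J'), Lp.coeFn_zero M 2 (volume.restrict J),
    ae_restrict_of_ae_restrict_of_subset hJ (Lp.coeFn_zero M 2 (volume.restrict J'))]
    with x h1 h2 h3
  rw [h1, h2, h3]

/-- The vacuum is `e(0)`, and both restrictions of the zero function vanish; hence it is a product
vector. -/
theorem factor_tmul_vacuum (t : ℝ≥0) (u : H) :
    factor M H t (HTensor.tmul u (vacuum M (Ici 0))) =
      HTensor.tmul (HTensor.tmul u (vacuum M (Ico 0 (t : ℝ)))) (vacuum M (Ici (t : ℝ))) := by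
  rw [vacuum, factor_tmul, before, after, restrictL2_zero, restrictL2_zero]
  rfl

/-- The adjoint of a unitary is its inverse. In this form the identification is ultraweakly
continuous and can be merged with slices by `compress_compress`. -/
theorem factorOp_eq_compress (t : ℝ≥0)
    (T : HTensor H (Fock M (Ici 0)) →L[ℂ] HTensor H (Fock M (Ici 0))) :
    factorOp M H t T =
      compress ((factor M H t).symm.toContinuousLinearEquiv : _ →L[ℂ] _) T := by
  ext y
  refine ext_inner_left ℂ fun x => ?_
  rw [inner_compress]
  exact (LinearIsometryEquiv.inner_map_eq_flip (factor M H t).symm x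
    (T ((factor M H t).symm y))).symm

/-- The vacuum slice of an operator on `h ⊗ F` can be taken in two steps, over `F_{[t,∞)}` and over
`F_{[0,t)}`. -/
theorem compress_E_vacuum_factorOp (t : ℝ≥0)
    (T : HTensor H (Fock M (Ici 0)) →L[ℂ] HTensor H (Fock M (Ici 0))) :
    compress (HTensor.E H (vacuum M (Ico 0 (t : ℝ))))
        (compress (HTensor.E _ (vacuum M (Ici (t : ℝ)))) (factorOp M H t T)) =
      compress (HTensor.E H (vacuum M (Ici 0))) T := by
  rw [factorOp_eq_compress, compress_compress, compress_compress]
  -- Each side is now a single compression of `T`, so only the compressing operators need comparing: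
  -- the inverse of `factor` sends `(u ⊗ Ω_{t)}) ⊗ Ω_{[t}` to `u ⊗ Ω`.
  refine congrArg (fun V => compress V T) ?_
  ext u
  exact ((factor M H t).symm_apply_eq).2 (factor_tmul_vacuum t u).symm

theorem continuous_factorOp (t : ℝ≥0) :
    Continuous[ultraweak (HTensor H (Fock M (Ici 0))),
      ultraweak (HTensor (HTensor H (Fock M (Ico 0 (t : ℝ)))) (Fock M (Ici (t : ℝ))))]
      (factorOp M H t) := by
  have h : factorOp M H t =
      compress ((factor M H t).symm.toContinuousLinearEquiv :
        HTensor (HTensor H (Fock M (Ico 0 (t : ℝ)))) (Fock M (Ici (t : ℝ))) →L[ℂ]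
          HTensor H (Fock M (Ici 0))) :=
    LinearMap.ext (factorOp_eq_compress t)
  rw [h]
  exact continuous_compress _

theorem shiftFock_vacuum (t : ℝ≥0) : shiftFock M t (vacuum M (Ici 0)) = vacuum M (Ici (t : ℝ)) := by
  rw [vacuum, shiftFock_expVec, map_zero, vacuum]

/-- The shift leaves the vacuum slice invariant. -/
theorem slice_vacuum_shiftOp (A : VonNeumannAlgebra H) (t : ℝ≥0)
    (T : uwTensor A (Fock M (Ici 0))) :
    slice A (vacuum M (Ici (t : ℝ))) (shiftOp M A t T) = vacuumExpectation M A T := by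
  refine Subtype.ext ?_
  ext v
  refine ext_inner_left ℂ fun u => ?_
  have h : ∀ w : H, ContinuousLinearMap.adjoint (HTensor.map (ContinuousLinearMap.id ℂ H)
      (shiftFock M t).toContinuousLinearMap) (HTensor.tmul w (vacuum M (Ici (t : ℝ)))) =
        HTensor.tmul w (vacuum M (Ici 0)) := by
    intro w
    -- As `S_t` is an isometry, `S_t† Ω_{[t} = S_t† S_t Ω = Ω`; surjectivity of `S_t` plays no role.
    have h1 : ContinuousLinearMap.adjoint (shiftFock M t).toContinuousLinearMap
        (vacuum M (Ici (t : ℝ))) = vacuum M (Ici 0) := by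
      refine ext_inner_left ℂ fun x => ?_
      rw [ContinuousLinearMap.adjoint_inner_right, ← shiftFock_vacuum]
      exact (shiftFock M t).inner_map_map _ _
    have h2 : ContinuousLinearMap.adjoint (ContinuousLinearMap.id ℂ H) =
      ContinuousLinearMap.id ℂ H := ContinuousLinearMap.adjoint_id
    rw [HTensor.adjoint_map, HTensor.map_tmul, h1, h2, ContinuousLinearMap.id_apply]
  change ⟪u, compress _ (_ ∘L _ ∘L _) v⟫_ℂ = ⟪u, compress _ _ v⟫_ℂ
  rw [inner_compress, inner_compress, ContinuousLinearMap.comp_apply,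
    ContinuousLinearMap.comp_apply, ← ContinuousLinearMap.adjoint_inner_left]
  simp only [HTensor.E_apply, h]
  rfl

end Fock

/-! ### The semigroup law from the cocycle identity. -/

section Cocycle

open Set

variable {H M : Type*} [NormedAddCommGroup H] [InnerProductSpace ℂ H] [CompleteSpace H]
  [NormedAddCommGroup M] [InnerProductSpace ℂ M] [CompleteSpace M] {A : VonNeumannAlgebra H}

/-- `beforePart` is already the future slice, so the past slice completes the vacuum expectation.
With `φ = k_s` this turns `k_{s)}` into `P_s`. -/
theorem compress_E_vacuum_beforePart (t : ℝ≥0)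
    (φ : opSpace A →ₗ[ℂ] uwTensor A (Fock M (Ici 0))) (a : opSpace A) :
    compress (HTensor.E H (vacuum M (Ico 0 (t : ℝ)))) (beforePart t φ a) =
      vacuumExpectation M A (φ a) :=
  compress_E_vacuum_factorOp t (φ a : HTensor H (Fock M (Ici 0)) →L[ℂ] HTensor H (Fock M (Ici 0)))

theorem IsNormal.continuous_beforePart {t : ℝ≥0}
    {φ : opSpace A →ₗ[ℂ] uwTensor A (Fock M (Ici 0))} (hφ : IsNormal φ) :
    Continuous[ultraweakOn _, ultraweak _] (beforePart t φ) := by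
  let _ := ultraweak H
  let _ := ultraweak (HTensor H (Fock M (Ici 0)))
  let _ := ultraweak (HTensor H (Fock M (Ico 0 (t : ℝ))))
  let _ := ultraweak (HTensor (HTensor H (Fock M (Ico 0 (t : ℝ)))) (Fock M (Ici (t : ℝ))))
  exact (continuous_compress _).comp ((continuous_factorOp t).comp
    ((continuous_subtype_ultraweak _).comp hφ))

namespace IsVacuumAdaptedCocycle

variable {k : ℝ≥0 → (opSpace A →ₗ[ℂ] uwTensor A (Fock M (Ici 0)))}

/-- In the cocycle identity `k_{s)} ⊗ id` is the genuine tensor product: the identity at `t = 0`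
shows that it can only be the default value `0` when `k_{s)} = 0`, and `0 ⊗ id = 0`. -/
theorem isTensorId (hk : IsVacuumAdaptedCocycle k) (s : ℝ≥0) :
    IsTensorId (beforePart s (k s))
      (tensorId (Fock M (Ici (s : ℝ))) (beforePart s (k s))) := by
  refine isTensorId_tensorId ?_
  by_contra hne
  refine hne ?_
  -- If no tensor product map existed, `tensorId` would be `0`. The cocycle identity at `t = 0`,
  -- whose left side involves `k_s(a)` itself, would then make `k_s(a)` vanish after factorization.
  -- But the zero map does have a tensor product with the identity.
  have h0 : beforePart s (k s) = 0 := by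
    ext1 a
    have h := hk.cocycle s 0 a
    rw [add_zero, tensorId, dif_neg hne] at h
    change compress _ (factorOp M H s (k s a)) = 0
    rw [h]
    simp
  exact ⟨0, h0 ▸ isTensorId_zero A⟩

theorem vacuumExpectation_add (hk : IsVacuumAdaptedCocycle k) (s t : ℝ≥0) (a : opSpace A) :
    vacuumExpectation M A (k (s + t) a) =
      vacuumExpectation M A (k s (vacuumExpectation M A (k t a))) := by
  refine Subtype.ext ?_
  -- The right side is unfolded: `P_s` becomes the past slice of `k_{s)}`, and `P_t(a)` the future
  -- slice of `σ_s(k_t(a))`. Moving that slice outside `k_{s)}` exposes the cocycle identity, and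
  -- the two slices recombine into `𝔼`.
  rw [← compress_E_vacuum_beforePart s (k s), ← slice_vacuum_shiftOp A s (k t a),
    ← (hk.isTensorId s).compress_E (hk.normal s).continuous_beforePart, ← hk.cocycle]
  exact (compress_E_vacuum_factorOp s _).symm

theorem vacuumExpectation_zero (hk : IsVacuumAdaptedCocycle k) (a : opSpace A) :
    vacuumExpectation M A (k 0 a) = a := by
  refine Subtype.ext ?_
  change compress _ (k 0 a : HTensor H (Fock M (Ici 0)) →L[ℂ] HTensor H (Fock M (Ici 0))) = _
  rw [hk.initial, compress_E_map, inner_vacuumProj_vacuum, one_smul]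

theorem isUltraweakSemigroup (hk : IsVacuumAdaptedCocycle k) :
    IsUltraweakSemigroup fun t : ℝ≥0 => vacuumExpectation M A ∘ₗ k t where
  zero := LinearMap.ext hk.vacuumExpectation_zero
  add s t := LinearMap.ext (hk.vacuumExpectation_add s t)
  continuous a := @Continuous.comp _ _ _ _ (ultraweakOn _) (ultraweakOn _) _ _
    (continuous_slice A (vacuum M (Ici 0))) (hk.continuous a)

end IsVacuumAdaptedCocycle

end Cocycle

end QS

theorem proposition2p3 {h M : Type*}
    [NormedAddCommGroup h] [InnerProductSpace ℂ h] [CompleteSpace h]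
    [NormedAddCommGroup M] [InnerProductSpace ℂ M] [CompleteSpace M]
    (A : VonNeumannAlgebra h)
    (k : ℝ≥0 → (QS.opSpace A →ₗ[ℂ] QS.uwTensor A (QS.Fock M (Set.Ici 0))))
    (hk : QS.IsVacuumAdaptedCocycle k) :
    (∀ t : ℝ≥0, QS.IsNormal (QS.vacuumExpectation M A ∘ₗ k t) ∧
      QS.IsCompletelyBounded (QS.vacuumExpectation M A ∘ₗ k t)) ∧
    QS.IsUltraweakSemigroup (fun t : ℝ≥0 => QS.vacuumExpectation M A ∘ₗ k t) :=
  ⟨fun t => ⟨(hk.normal t).slice_comp _, (hk.completelyBounded t).slice_comp _⟩,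
    hk.isUltraweakSemigroup⟩
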